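/- Let $1\le K\le N$ and $M\ge 1$ be integers, let $\mathbb F_q$ be a finite field, and let $\mathbf H=[\mathbf h_1,\dots,\mathbf h_N]\in\mathbb F_q^{K\times N}$ be such that any at most $K$ of its columns are linearly independent (an $(N,K)$ MDS code); put $R_c=K/N$. Messages $W_1,\dots,W_M$ are matrices in $\mathbb F_q^{\tilde L\times K}$ with all entries independent and uniform over $\mathbb F_q$, where $\tilde L\ge1$ is arbitrary. Database $n$ stores $\mathbf y_n=(W_1\mathbf h_n,\dots,W_M\mathbf h_n)$, for $n=1,\dots,N$. A retrieval scheme consists, for each desired index $i\in\{1,\dots,M\}$, of discrete random queries $(Q_1^{[i]},\dots,Q_N^{[i]})$ that are independent of $(W_1,\dots,W_M)$, and of answers $A_n^{[i]}$, each being a deterministic function (not depending on $i$) of $Q_n^{[i]}$ and $\mathbf y_n$. The scheme has to be private against every single database (for each $n$, the distribution of $Q_n^{[i]}$ does not depend on $i$) and reliable: $H\big(W_i\mid A_1^{[i]},\dots,A_N^{[i]},Q_1^{[i]},\dots,Q_N^{[i]}\big)=0$ for each $i$. Its rate is $R=H(W_i)\big/\sum_{n=1}^N H(A_n^{[i]})$,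 which for a private scheme does not depend on $i$, and the PIR capacity $C$ is the supremum of $R$ over all $\tilde L\ge 1$ and all private and reliable schemes. Then $$C=\Big(1+\frac KN+\frac{K^2}{N^2}+\cdots+\frac{K^{M-1}}{N^{M-1}}\Big)^{-1},$$ which, for $K<N$, equals $\dfrac{1-R_c}{1-R_c^M}$. Moreover, the supremum is attained by a scheme with $\tilde L=N^M$, that is, with messages of $KN^M$ symbols of $\mathbb F_q$. -/

import Mathlib

open scoped ENNReal

noncomputable section

namespace CodedPIR

universe u

/-! ### Shannon entropy of discrete random variables

A random variable is a function `X` on a discrete probability space `(Ω, μ)`. Entropies take values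
in `[0, ∞]` and use the natural logarithm; the retrieval rate below is a ratio of two entropies, so
it does not depend on the base. -/

/-- Shannon entropy `H(X) = -∑ₓ P(x) log P(x)`. -/
def entropy {Ω α : Type*} (μ : PMF Ω) (X : Ω → α) : ℝ≥0∞ :=
  ∑' x, ENNReal.ofReal (Real.negMulLog ((μ.map X) x).toReal)

/-- Conditional Shannon entropy `H(X | Y) = ∑_{x,y} P(x,y) log (P(y) / P(x,y))`. -/
def condEntropy {Ω α β : Type*} (μ : PMF Ω) (X : Ω → α) (Y : Ω → β) : ℝ≥0∞ :=
  ∑' z : α × β, (μ.map fun ω => (X ω, Y ω)) z *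
    ENNReal.ofReal (Real.log ((μ.map Y) z.2 / (μ.map fun ω => (X ω, Y ω)) z).toReal)

/-! ### The coded storage system -/

/-- Any at most `K` columns of the `K × N` generator matrix are linearly independent. -/
def IsMDS {F : Type u} [Field F] {K N : ℕ} (H : Matrix (Fin K) (Fin N) F) : Prop :=
  ∀ s : Finset (Fin N), s.card ≤ K → LinearIndependent F (fun n : s => fun k : Fin K => H k n)

/-- The contents of the `M` messages, each an `ℓ × K` matrix over `F`. -/
abbrev Messages (F : Type u) (K M ℓ : ℕ) : Type u := Fin M → Matrix (Fin ℓ) (Fin K) F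

/-- The contents of database `n`: the entry for row `j` of message `i` is `hₙᵀ w_j^{[i]}`, where
`hₙ` is the `n`-th column of `H`. -/
def stored {F : Type u} [Field F] {K N M ℓ : ℕ} (H : Matrix (Fin K) (Fin N) F) (n : Fin N)
    (W : Messages F K M ℓ) : Fin M → Fin ℓ → F :=
  fun i j => ∑ k, H k n * W i j k

/-! ### Retrieval schemes -/

/-- The data of a retrieval scheme. To retrieve message `i`, the user draws the queries
`(Q₁, …, Q_N)` from `queryLaw i`. Database `n` replies with a deterministic function of the query
it receives and of its own contents. The queries and the answers are arbitrary discrete random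
variables; using one alphabet for all databases is no restriction. -/
structure Scheme (F : Type u) (N M ℓ : ℕ) where
  Query : Type
  Answer : Type
  queryLaw : Fin M → PMF (Fin N → Query)
  answer : Fin N → Query → (Fin M → Fin ℓ → F) → Answer

namespace Scheme

variable {F : Type u} [Field F] [Fintype F] {K N M ℓ : ℕ}

/-- The joint law of messages and queries when message `i` is desired: all symbols of the messages
are independent and uniform over `F`, and the queries are independent of the messages. -/
def law (K : ℕ) (S : Scheme F N M ℓ) (i : Fin M) :
    PMF (Messages F K M ℓ × (Fin N → S.Query)) :=
  (PMF.uniformOfFintype (Messages F K M ℓ)).bind fun W => (S.queryLaw i).map fun Q => (W, Q)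

/-- The answer of database `n`, as a random variable. -/
def answerRV (H : Matrix (Fin K) (Fin N) F) (S : Scheme F N M ℓ) (n : Fin N)
    (ω : Messages F K M ℓ × (Fin N → S.Query)) : S.Answer :=
  S.answer n (ω.2 n) (stored H n ω.1)

/-- Privacy against each single database: the query seen by database `n` has the same distribution
for every desired message. -/
def IsPrivate (S : Scheme F N M ℓ) : Prop :=
  ∀ (n : Fin N) (i j : Fin M),
    (S.queryLaw i).map (fun Q => Q n) = (S.queryLaw j).map (fun Q => Q n)

/-- Reliability: `H(Wᵢ | A₁, …, A_N, Q₁, …, Q_N) = 0` when message `i` is desired. -/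
def IsReliable (H : Matrix (Fin K) (Fin N) F) (S : Scheme F N M ℓ) : Prop :=
  ∀ i : Fin M,
    condEntropy (S.law K i) (fun ω => ω.1 i) (fun ω => (fun n => S.answerRV H n ω, ω.2)) = 0

/-- The retrieval rate `H(Wᵢ) / ∑ₙ H(Aₙ)` when message `i` is desired. -/
def rate (H : Matrix (Fin K) (Fin N) F) (S : Scheme F N M ℓ) (i : Fin M) : ℝ≥0∞ :=
  entropy (S.law K i) (fun ω => ω.1 i) / ∑ n, entropy (S.law K i) (S.answerRV H n)

end Scheme

/-- The PIR capacity: the supremum of the retrieval rate over all message sizes and all private and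
reliable schemes. (For a private scheme the rate is the same for every desired message, so that
the infimum over `i` is just this common value.) -/
def capacity {F : Type u} [Field F] [Fintype F] {K N : ℕ} (H : Matrix (Fin K) (Fin N) F)
    (M : ℕ) : ℝ≥0∞ :=
  ⨆ (ℓ : ℕ) (_ : 0 < ℓ) (S : Scheme F N M ℓ) (_ : S.IsPrivate) (_ : S.IsReliable H),
    ⨅ i : Fin M, S.rate H i

end CodedPIR

end

/-!
The upper bound on the rate is a recursion over the set `T` of messages already known. Fix the
queries. The answers reveal the desired message `i ∉ T`, so that, conditionally on the messages in
`T`, they carry `H(Wᵢ)` plus their entropy given the messages in `T ∪ {i}`. Since any `K` columns of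
`H` form a basis, the contents of any `K` databases are independent, also given some of the
messages; the entropy of all the answers is therefore at least the sum of the entropies of the
answers of any `K` databases, and averaging over the `N` cyclic windows of `K` databases gives the
fraction `K / N` of the sum over all databases (`log_card_add_le_sum_answerEntropy`). By privacy the
expectation of that sum over the queries does not depend on the desired message, so the next step
may desire another one (`Scheme.geom_le_download`). Finally conditioning on the queries decreases
entropy (`Scheme.download_empty_le`). For fixed queries all random variables are functions of a
uniform element of a finite set, and their entropies are logarithms of class sizes of partitions of
this set.

The rate is achieved by sums of symbols. Write `k` for the number of messages in a nonempty set `T`.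
Each database returns `K ^ (M - k + 1) * (N - K) ^ (k - 1)` sums of one symbol of each of the
messages in `T`. When message `i ∉ T` is desired, the sums of type `T` and those of type `T ∪ {i}`
use the same sums of rows of the messages in `T`: such a sum is a codeword, `K` databases return
their symbol of it, which determines the codeword, and the other `N - K` databases return their
symbol of it added to a desired one. Counting shows that the `N ^ M` rows of each message suffice to
give each database distinct rows and to let each row of the desired message be read by `K` databases
(`exists_placement`). Permuting the rows of each message uniformly at random then hides the desired
index from each database (`map_uniform_perm_congr`). The answers have a fixed length, which bounds
their entropies from above; the converse shows that the bound is attained.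
-/

namespace CodedPIR

/-! ### Entropy of discrete random variables -/

section Entropy

variable {Ω α β : Type*}

theorem tsum_map_mul (p : PMF Ω) (f : Ω → α) (g : α → ℝ≥0∞) :
    ∑' b, (p.map f) b * g b = ∑' a, p a * g (f a) := by
  classical
  simp_rw [PMF.map_apply, ← ENNReal.tsum_mul_right]
  rw [ENNReal.tsum_comm]
  refine tsum_congr fun a => ?_
  rw [tsum_eq_single (f a)]
  · simp
  · intro b hb
    simp [hb]

theorem ofReal_negMulLog_toReal (x : ℝ≥0∞) (hx : x ≠ ⊤) :
    ENNReal.ofReal (Real.negMulLog x.toReal) = x * ENNReal.ofReal (-Real.log x.toReal) := by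
  rw [Real.negMulLog, neg_mul_comm, ENNReal.ofReal_mul ENNReal.toReal_nonneg,
    ENNReal.ofReal_toReal hx]

theorem negMulLog_add_le {v t : ℝ} (hv : 0 ≤ v) (ht : 0 < t) :
    Real.negMulLog v + v ≤ v * (-Real.log t) + t := by
  rcases hv.eq_or_lt with rfl | hv
  · simp [ht.le]
  have h := Real.log_le_sub_one_of_pos (div_pos ht hv)
  rw [Real.log_div ht.ne' hv.ne'] at h
  have h2 := mul_le_mul_of_nonneg_left h hv.le
  have h3 : v * (t / v - 1) = t - v := by field_simp
  rw [Real.negMulLog]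
  linarith

theorem toReal_apply_le_one (p : PMF α) (x : α) : (p x).toReal ≤ 1 :=
  ENNReal.toReal_le_of_le_ofReal zero_le_one (by simpa using p.coe_le_one x)

/-- Concavity of entropy: conditioning on the index of a mixture decreases entropy. -/
theorem tsum_mul_entropy_le (p : PMF β) (u : β → PMF α) :
    ∑' q, p q * ∑' x, ENNReal.ofReal (Real.negMulLog (u q x).toReal) ≤
      ∑' x, ENNReal.ofReal (Real.negMulLog (p.bind u x).toReal) := by
  simp_rw [← ENNReal.tsum_mul_left]
  rw [ENNReal.tsum_comm]
  refine ENNReal.tsum_le_tsum fun x => ?_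
  have hfin : p.bind u x ≠ ⊤ := PMF.apply_ne_top _ _
  rcases eq_or_ne (p.bind u x) 0 with h0 | h0
  · rw [PMF.bind_apply, ENNReal.tsum_eq_zero] at h0
    have : ∀ q, p q * ENNReal.ofReal (Real.negMulLog (u q x).toReal) = 0 := fun q => by
      rcases mul_eq_zero.1 (h0 q) with h | h <;> simp [h]
    simp [this]
  set t := (p.bind u x).toReal with ht
  have htpos : 0 < t := ENNReal.toReal_pos h0 hfin
  have hlog : 0 ≤ -Real.log t := by
    have := Real.log_nonpos htpos.le (toReal_apply_le_one (p.bind u) x)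
    linarith
  -- the tangent line of `negMulLog` at the mixture probability
  have key : ∀ q, ENNReal.ofReal (Real.negMulLog (u q x).toReal) + u q x ≤
      u q x * ENNReal.ofReal (-Real.log t) + ENNReal.ofReal t := fun q => by
    have hu : u q x = ENNReal.ofReal (u q x).toReal :=
      (ENNReal.ofReal_toReal (PMF.apply_ne_top _ _)).symm
    have hn : 0 ≤ Real.negMulLog (u q x).toReal :=
      Real.negMulLog_nonneg ENNReal.toReal_nonneg (toReal_apply_le_one _ _)
    calc _ = ENNReal.ofReal (Real.negMulLog (u q x).toReal + (u q x).toReal) := by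
          rw [ENNReal.ofReal_add hn ENNReal.toReal_nonneg, ← hu]
      _ ≤ ENNReal.ofReal ((u q x).toReal * (-Real.log t) + t) :=
          ENNReal.ofReal_le_ofReal (negMulLog_add_le ENNReal.toReal_nonneg htpos)
      _ = _ := by
          rw [ENNReal.ofReal_add (mul_nonneg ENNReal.toReal_nonneg hlog) htpos.le,
            ENNReal.ofReal_mul ENNReal.toReal_nonneg, ← hu]
  have hsum : ∑' q, p q * ENNReal.ofReal (Real.negMulLog (u q x).toReal) + p.bind u x ≤
      p.bind u x * ENNReal.ofReal (-Real.log t) + ENNReal.ofReal t := by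
    rw [PMF.bind_apply, ← ENNReal.tsum_add, ← ENNReal.tsum_mul_right]
    calc _ ≤ ∑' q, (p q * u q x * ENNReal.ofReal (-Real.log t) + p q * ENNReal.ofReal t) := by
          refine ENNReal.tsum_le_tsum fun q => ?_
          rw [← mul_add, mul_assoc, ← mul_add]
          exact mul_le_mul_right (key q) _
      _ = _ := by rw [ENNReal.tsum_add, ENNReal.tsum_mul_right (a := ENNReal.ofReal t), p.tsum_coe,
            one_mul]
  rw [ofReal_negMulLog_toReal _ hfin]
  rw [ht, ENNReal.ofReal_toReal hfin] at hsum
  exact (ENNReal.add_le_add_iff_right hfin).1 hsum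

theorem entropy_le_log_card [Fintype α] (μ : PMF Ω) (X : Ω → α) :
    entropy μ X ≤ ENNReal.ofReal (Real.log (Fintype.card α)) := by
  set p := μ.map X
  have hne : Nonempty α := ⟨p.support_nonempty.some⟩
  have hc : (0 : ℝ) < Fintype.card α := by exact_mod_cast Fintype.card_pos
  have hsum : ∑ x, (p x).toReal = 1 := by
    rw [← ENNReal.toReal_sum fun x _ => PMF.apply_ne_top _ _, ← tsum_fintype (L := .unconditional _),
      p.tsum_coe, ENNReal.toReal_one]
  rw [entropy, tsum_fintype, ← ENNReal.ofReal_sum_of_nonneg fun x _ =>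
    Real.negMulLog_nonneg ENNReal.toReal_nonneg (toReal_apply_le_one _ _)]
  refine ENNReal.ofReal_le_ofReal ?_
  have h := Finset.sum_le_sum fun x (_ : x ∈ Finset.univ) =>
    negMulLog_add_le (v := (p x).toReal) ENNReal.toReal_nonneg (inv_pos.2 hc)
  rw [Finset.sum_add_distrib, Finset.sum_add_distrib, ← Finset.sum_mul, hsum] at h
  simp only [Real.log_inv, neg_neg, Finset.sum_const, Finset.card_univ, nsmul_eq_mul,
    mul_inv_cancel₀ hc.ne'] at h
  linarith

/-- A conditional entropy vanishes exactly when the conditioning variable determines the other one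
on the support. -/
theorem condEntropy_eq_zero_iff (μ : PMF Ω) (X : Ω → α) (Y : Ω → β) :
    condEntropy μ X Y = 0 ↔ ∀ ω ∈ μ.support, ∀ ω' ∈ μ.support, Y ω = Y ω' → X ω = X ω' := by
  classical
  have hY : ∀ y, μ.map Y y = ∑' x, μ.map (fun ω => (X ω, Y ω)) (x, y) := fun y => by
    simp_rw [PMF.map_apply, Prod.mk.injEq]
    rw [ENNReal.tsum_comm]
    refine tsum_congr fun ω => ?_
    rw [tsum_eq_single (X ω)]
    · simp
    · intro x hx
      simp [hx]
  rw [condEntropy, ENNReal.tsum_eq_zero]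
  set P := μ.map fun ω => (X ω, Y ω) with hP
  have hsupp : ∀ z, P z ≠ 0 ↔ ∃ ω ∈ μ.support, (X ω, Y ω) = z := fun z => by
    rw [← PMF.mem_support_iff, hP, PMF.mem_support_map_iff]
  constructor
  · intro h ω hω ω' hω' hyy
    by_contra hx
    have h1 : P (X ω, Y ω) ≠ 0 := (hsupp _).2 ⟨ω, hω, rfl⟩
    have h2 : P (X ω', Y ω) ≠ 0 := (hsupp _).2 ⟨ω', hω', by rw [hyy]⟩
    have h3 := (mul_eq_zero.1 (h (X ω, Y ω))).resolve_left h1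
    have hlt : P (X ω, Y ω) < μ.map Y (Y ω) := by
      refine lt_of_lt_of_le (ENNReal.lt_add_right (PMF.apply_ne_top _ _) h2) ?_
      rw [hY, ← Finset.sum_pair (f := fun x => P (x, Y ω)) hx]
      exact ENNReal.sum_le_tsum _
    have h4 : 1 < (μ.map Y (Y ω) / P (X ω, Y ω)).toReal := by
      rw [← ENNReal.toReal_one]
      refine (ENNReal.toReal_lt_toReal ENNReal.one_ne_top
        (ENNReal.div_ne_top (PMF.apply_ne_top _ _) h1)).2 ?_
      rw [ENNReal.lt_div_iff_mul_lt (.inl h1) (.inl (PMF.apply_ne_top _ _)), one_mul]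
      exact hlt
    rw [ENNReal.ofReal_eq_zero] at h3
    exact absurd h3 (not_le.2 (Real.log_pos h4))
  · rintro h ⟨x, y⟩
    by_cases h0 : P (x, y) = 0
    · simp [h0]
    obtain ⟨ω, hω, hz⟩ := (hsupp _).1 h0
    have : μ.map Y y = P (x, y) := by
      rw [hY, tsum_eq_single x]
      intro x' hx'
      by_contra h1
      obtain ⟨ω', hω', hz'⟩ := (hsupp _).1 h1
      simp only [Prod.mk.injEq] at hz hz'
      exact hx' (by rw [← hz'.1, ← hz.1]; exact h _ hω' _ hω (by rw [hz.2, hz'.2]))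
    simp only [this]
    rw [ENNReal.div_self h0 (PMF.apply_ne_top _ _)]
    simp

theorem entropy_eq_of_map_eq_uniform [Fintype α] [Nonempty α] (μ : PMF Ω) (X : Ω → α)
    (h : μ.map X = PMF.uniformOfFintype α) :
    entropy μ X = ENNReal.ofReal (Real.log (Fintype.card α)) := by
  have hc : (Fintype.card α : ℝ) ≠ 0 := by exact_mod_cast Fintype.card_ne_zero
  rw [entropy, h, tsum_fintype]
  simp only [PMF.uniformOfFintype_apply, ENNReal.toReal_inv, ENNReal.toReal_natCast,
    Finset.sum_const, Finset.card_univ, nsmul_eq_mul, Real.negMulLog, Real.log_inv]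
  rw [← ENNReal.ofReal_natCast, ← ENNReal.ofReal_mul (Nat.cast_nonneg _)]
  congr 1
  field_simp

theorem map_uniformOfFintype_equiv [Fintype α] [Nonempty α] (e : α ≃ α) :
    (PMF.uniformOfFintype α).map e = PMF.uniformOfFintype α := by
  classical
  ext x
  rw [PMF.map_apply, tsum_eq_single (e.symm x)]
  · simp
  · intro y hy
    rw [if_neg]
    rintro rfl
    simp at hy

theorem map_uniformOfFintype_eval {ι : Type*} [Fintype ι] [DecidableEq ι] [Fintype α] [Nonempty α]
    (i : ι) :
    (PMF.uniformOfFintype (ι → α)).map (fun W => W i) = PMF.uniformOfFintype α := by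
  classical
  ext x
  have hc : (Fintype.card α : ℝ≥0∞) ≠ 0 := by exact_mod_cast Fintype.card_ne_zero
  have h := Fintype.card_filter_piFinset_const_eq_of_mem (Finset.univ : Finset α) i
    (Finset.mem_univ x)
  rw [Fintype.piFinset_univ, Finset.card_univ] at h
  rw [PMF.map_apply, tsum_fintype]
  simp only [PMF.uniformOfFintype_apply, eq_comm (a := x)]
  rw [← Finset.sum_filter, Finset.sum_const, h, Fintype.card_fun, nsmul_eq_mul]
  obtain ⟨k, hk⟩ : ∃ k, Fintype.card ι = k + 1 :=
    Nat.exists_eq_succ_of_ne_zero (Fintype.card_pos_iff.2 ⟨i⟩).ne'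
  rw [hk, Nat.add_sub_cancel, pow_succ]
  push_cast
  rw [ENNReal.mul_inv (.inr (ENNReal.natCast_ne_top _)) (.inr hc), ← mul_assoc,
    ENNReal.mul_inv_cancel (pow_ne_zero _ hc) (ENNReal.pow_ne_top (ENNReal.natCast_ne_top _)),
    one_mul]

end Entropy

/-! ### Entropies on a finite uniform space, by counting -/

section Counting

variable {Ω : Type*} [Fintype Ω]

open Classical in
/-- The number of outcomes that a partition `r` of the outcomes does not distinguish from `ω`. -/
noncomputable def classCard (r : Setoid Ω) (ω : Ω) : ℕ := (Finset.univ.filter fun ω' => r ω ω').card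

/-- The unnormalised entropy of a uniform outcome given its class under the partition `r`.
A random variable `f` enters through the partition `Setoid.ker f`, and a pair of random variables
through the infimum of their partitions; hence `logClass g - logClass (g ⊓ f)` is `|Ω|` times the
conditional entropy of `f` given `g`. -/
noncomputable def logClass (r : Setoid Ω) : ℝ := ∑ ω, Real.log (classCard r ω)

theorem classCard_pos (r : Setoid Ω) (ω : Ω) : 0 < classCard r ω :=
  Finset.card_pos.2 ⟨ω, by simp⟩

theorem classCard_congr (r : Setoid Ω) {ω ω' : Ω} (h : r ω ω') :
    classCard r ω = classCard r ω' := by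
  unfold classCard
  congr 1
  ext x
  simp only [Finset.mem_filter, Finset.mem_univ, true_and]
  exact ⟨fun hx => r.trans' (r.symm' h) hx, fun hx => r.trans' h hx⟩

theorem logClass_mono {r s : Setoid Ω} (h : r ≤ s) : logClass r ≤ logClass s := by
  refine Finset.sum_le_sum fun ω _ => Real.log_le_log (by exact_mod_cast classCard_pos r ω) ?_
  unfold classCard
  exact_mod_cast Finset.card_le_card fun x hx => by
    simp only [Finset.mem_filter, Finset.mem_univ, true_and] at hx ⊢
    exact h hx

/-- The numerator counts the pairs `(u, v)` with `u` in the `a`-class and `v` in the `b`-class of `ω`.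
Such a pair lies in one class of `g`, and the `ω` belonging to a given pair form at most one class
of `a ⊓ b`, so that each pair contributes at most the inverse of the size of its `g`-class. -/
theorem sum_classCard_ratio_le {g a b : Setoid Ω} (ha : a ≤ g) (hb : b ≤ g) :
    ∑ ω, (classCard a ω * classCard b ω : ℝ) / (classCard g ω * classCard (a ⊓ b) ω) ≤
      Fintype.card Ω := by
  classical
  have hpair : ∀ ω, (classCard a ω * classCard b ω : ℝ) / (classCard g ω * classCard (a ⊓ b) ω) =
      ∑ u, ∑ v, if a ω u ∧ b ω v then (1 : ℝ) / (classCard g ω * classCard (a ⊓ b) ω) else 0 := by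
    intro ω
    have h1 : ∀ r : Setoid Ω, (classCard r ω : ℝ) = ∑ u, if r ω u then 1 else 0 := fun r => by
      rw [Finset.sum_boole, classCard]
    rw [h1 a, h1 b, Finset.sum_mul_sum, Finset.sum_div]
    refine Finset.sum_congr rfl fun u _ => ?_
    rw [Finset.sum_div]
    refine Finset.sum_congr rfl fun v _ => ?_
    by_cases hu : a ω u <;> by_cases hv : b ω v <;> simp [hu, hv]
  have hinner : ∀ u v, (∑ ω, if a ω u ∧ b ω v then
      (1 : ℝ) / (classCard g ω * classCard (a ⊓ b) ω) else 0) ≤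
      if g u v then (1 : ℝ) / classCard g u else 0 := by
    intro u v
    rcases (Finset.univ.filter fun ω => a ω u ∧ b ω v).eq_empty_or_nonempty with he | ⟨ω₀, h₀⟩
    · rw [← Finset.sum_filter, he, Finset.sum_empty]
      positivity
    · simp only [Finset.mem_filter, Finset.mem_univ, true_and] at h₀
      rw [if_pos (g.trans' (g.symm' (ha h₀.1)) (hb h₀.2)), ← Finset.sum_filter]
      have hset : (Finset.univ.filter fun ω => a ω u ∧ b ω v) =
          Finset.univ.filter fun ω => (a ⊓ b) ω₀ ω := by
        ext ω
        simp only [Finset.mem_filter, Finset.mem_univ, true_and]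
        exact ⟨fun h => ⟨a.trans' h₀.1 (a.symm' h.1), b.trans' h₀.2 (b.symm' h.2)⟩,
          fun h => ⟨a.trans' (a.symm' h.1) h₀.1, b.trans' (b.symm' h.2) h₀.2⟩⟩
      have hconst : ∀ ω ∈ Finset.univ.filter (fun ω => (a ⊓ b) ω₀ ω),
          (1 : ℝ) / (classCard g ω * classCard (a ⊓ b) ω) =
            1 / (classCard g u * classCard (a ⊓ b) ω₀) := by
        intro ω hω
        simp only [Finset.mem_filter, Finset.mem_univ, true_and] at hω
        rw [← classCard_congr _ hω,
          classCard_congr g (g.trans' (g.symm' (ha (inf_le_left (b := b) hω))) (ha h₀.1))]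
      rw [hset, Finset.sum_congr rfl hconst, Finset.sum_const, nsmul_eq_mul]
      have hcard : ((Finset.univ.filter fun ω => (a ⊓ b) ω₀ ω).card : ℝ) =
          classCard (a ⊓ b) ω₀ := by
        rw [classCard]
      rw [hcard]
      have h1 : (classCard (a ⊓ b) ω₀ : ℝ) ≠ 0 := by exact_mod_cast (classCard_pos _ _).ne'
      have h2 : (classCard g u : ℝ) ≠ 0 := by exact_mod_cast (classCard_pos _ _).ne'
      apply le_of_eq
      field_simp
  calc _ = ∑ u, ∑ v, ∑ ω, if a ω u ∧ b ω v then
          (1 : ℝ) / (classCard g ω * classCard (a ⊓ b) ω) else 0 := by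
        rw [Finset.sum_congr rfl fun ω _ => hpair ω, Finset.sum_comm]
        exact Finset.sum_congr rfl fun u _ => Finset.sum_comm
    _ ≤ ∑ u, ∑ v, if g u v then (1 : ℝ) / classCard g u else 0 :=
        Finset.sum_le_sum fun u _ => Finset.sum_le_sum fun v _ => hinner u v
    _ = ∑ _u : Ω, (1 : ℝ) := by
        refine Finset.sum_congr rfl fun u _ => ?_
        rw [← Finset.sum_filter, Finset.sum_const, nsmul_eq_mul]
        have h2 : (classCard g u : ℝ) ≠ 0 := by exact_mod_cast (classCard_pos _ _).ne'
        have hcard : ((Finset.univ.filter fun v => g u v).card : ℝ) = classCard g u := by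
          rw [classCard]
        rw [hcard, mul_one_div_cancel h2]
    _ = Fintype.card Ω := by simp

/-- Submodularity of entropy. -/
theorem logClass_add_le {g a b : Setoid Ω} (ha : a ≤ g) (hb : b ≤ g) :
    logClass a + logClass b ≤ logClass g + logClass (a ⊓ b) := by
  have hpos : ∀ (r : Setoid Ω) ω, (0 : ℝ) < classCard r ω := fun r ω => by
    exact_mod_cast classCard_pos r ω
  have h : ∀ ω, Real.log (classCard a ω) + Real.log (classCard b ω) -
      (Real.log (classCard g ω) + Real.log (classCard (a ⊓ b) ω)) ≤
      (classCard a ω * classCard b ω : ℝ) / (classCard g ω * classCard (a ⊓ b) ω) - 1 := by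
    intro ω
    have := Real.log_le_sub_one_of_pos (div_pos (mul_pos (hpos a ω) (hpos b ω))
      (mul_pos (hpos g ω) (hpos (a ⊓ b) ω)))
    rwa [Real.log_div (mul_pos (hpos _ _) (hpos _ _)).ne' (mul_pos (hpos _ _) (hpos _ _)).ne',
      Real.log_mul (hpos _ _).ne' (hpos _ _).ne', Real.log_mul (hpos _ _).ne' (hpos _ _).ne'] at this
  have hs := Finset.sum_le_sum fun ω (_ : ω ∈ Finset.univ) => h ω
  simp only [Finset.sum_sub_distrib, Finset.sum_add_distrib, Finset.sum_const, Finset.card_univ,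
    nsmul_eq_mul, mul_one] at hs
  have := sum_classCard_ratio_le ha hb
  unfold logClass
  linarith

/-- Subadditivity of conditional entropy. -/
theorem logClass_sub_inf_le {ι : Type*} (g : Setoid Ω) (s : Finset ι) (f : ι → Setoid Ω) :
    logClass g - logClass (g ⊓ s.inf f) ≤ ∑ n ∈ s, (logClass g - logClass (g ⊓ f n)) := by
  classical
  induction s using Finset.induction_on with
  | empty => simp
  | insert n s hn ih =>
    have h := logClass_add_le (g := g) (a := g ⊓ f n) (b := g ⊓ s.inf f) inf_le_left inf_le_left
    rw [← inf_inf_distrib_left] at h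
    rw [Finset.inf_insert, Finset.sum_insert hn]
    linarith

end Counting

/-! ### Any `K` databases store independent contents -/

section Storage

variable {F : Type*} [Field F] {K N M ℓ : ℕ}

theorem IsMDS.eq_zero_of_column_eq_zero {H : Matrix (Fin K) (Fin N) F} (hH : IsMDS H)
    {s : Finset (Fin N)} (hs : s.card = K) {v : Fin K → F}
    (hv : ∀ n ∈ s, ∑ k, H k n * v k = 0) : v = 0 := by
  have hspan := (hH s hs.le).span_eq_top_of_card_eq_finrank' (by simp [hs])
  have hker : ∀ x : Fin K → F, ∑ k, x k * v k = 0 := fun x => by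
    have hx : x ∈ Submodule.span F (Set.range fun n : s => fun k : Fin K => H k n) := by
      rw [hspan]; trivial
    induction hx using Submodule.span_induction with
    | mem x hx => obtain ⟨n, rfl⟩ := hx; exact hv n n.2
    | zero => simp
    | add x y _ _ hx hy => simp [add_mul, Finset.sum_add_distrib, hx, hy]
    | smul c x _ hx => simp [mul_assoc, ← Finset.mul_sum, hx]
  funext k
  simpa [Pi.single_apply] using hker (Pi.single k 1)

theorem IsMDS.eq_of_stored_eq {H : Matrix (Fin K) (Fin N) F} (hH : IsMDS H)
    {s : Finset (Fin N)} (hs : s.card = K) {W W' : Messages F K M ℓ} {j : Fin M}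
    (h : ∀ n ∈ s, stored H n W j = stored H n W' j) : W j = W' j := by
  ext r k
  have : (fun k => W j r k - W' j r k) = 0 := hH.eq_zero_of_column_eq_zero hs fun n hn => by
    have := congrFun (h n hn) r
    simp only [stored] at this
    simp [mul_sub, Finset.sum_sub_distrib, this]
  simpa [sub_eq_zero] using congrFun this k

theorem IsMDS.bijective_stored [Fintype F] {H : Matrix (Fin K) (Fin N) F} (hH : IsMDS H)
    {s : Finset (Fin N)} (hs : s.card = K) :
    Function.Bijective fun (W : Messages F K M ℓ) (n : s) => stored H n W := by
  classical
  rw [Fintype.bijective_iff_injective_and_card]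
  constructor
  · intro W W' h
    funext j
    exact hH.eq_of_stored_eq hs fun n hn => congrFun (congrFun h ⟨n, hn⟩) j
  · have hX : Fintype.card (Matrix (Fin ℓ) (Fin K) F) = Fintype.card F ^ (K * ℓ) := by
      rw [Fintype.card_congr (Matrix.of (m := Fin ℓ) (n := Fin K) (α := F)).symm]
      simp [pow_mul]
    simp only [Fintype.card_fun, Fintype.card_fin, Fintype.card_coe, hs, hX]
    simp only [← pow_mul]
    congr 1
    ring

/-- The partition of the message contents given by the values of the messages in `S`. -/
def agreeOn (F : Type*) (K ℓ : ℕ) {M : ℕ} (S : Finset (Fin M)) : Setoid (Messages F K M ℓ) where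
  r W W' := ∀ j ∈ S, W j = W' j
  iseqv := ⟨fun _ _ _ => rfl, fun h j hj => (h j hj).symm,
    fun h h' j hj => (h j hj).trans (h' j hj)⟩

omit [Field F] in
theorem agreeOn_apply {S : Finset (Fin M)} {W W' : Messages F K M ℓ} :
    agreeOn F K ℓ S W W' ↔ ∀ j ∈ S, W j = W' j := Iff.rfl

theorem setoid_inf_apply {Ω : Type*} (r s : Setoid Ω) (a b : Ω) :
    (r ⊓ s) a b ↔ r a b ∧ s a b := Iff.rfl

theorem finset_inf_setoid_apply {Ω ι : Type*} (s : Finset ι) (r : ι → Setoid Ω) (a b : Ω) :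
    s.inf r a b ↔ ∀ n ∈ s, r n a b := by
  classical
  induction s using Finset.induction_on with
  | empty =>
    rw [Finset.inf_empty]
    exact ⟨fun _ n hn => absurd hn (Finset.notMem_empty n), fun _ => trivial⟩
  | insert n s _ ih =>
    rw [Finset.inf_insert, setoid_inf_apply, ih, Finset.forall_mem_insert]

variable [Fintype F]

open Classical in
/-- Given the messages in `S`, the contents of `K` databases are independent: the number of message
contents compatible with given functions of the `K` contents is a product. -/
theorem IsMDS.classCard_eq_prod {H : Matrix (Fin K) (Fin N) F} (hH : IsMDS H)
    {s : Finset (Fin N)} (hs : s.card = K) (S : Finset (Fin M)) {α : Type*}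
    (f : Fin N → (Fin M → Fin ℓ → F) → α) (W : Messages F K M ℓ) :
    classCard (agreeOn F K ℓ S ⊓ s.inf fun n => Setoid.ker fun W => f n (stored H n W)) W =
      ∏ n ∈ s, (Finset.univ.filter fun y : Fin M → Fin ℓ → F =>
        (∀ j ∈ S, stored H n W j = y j) ∧ f n (stored H n W) = f n y).card := by
  rw [← Finset.prod_coe_sort, ← Fintype.card_piFinset, classCard]
  refine Finset.card_bijective _ (hH.bijective_stored hs) fun W' => ?_
  simp only [Finset.mem_filter, Finset.mem_univ, true_and, Fintype.mem_piFinset, setoid_inf_apply,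
    finset_inf_setoid_apply, agreeOn_apply, Setoid.ker_def]
  constructor
  · rintro ⟨h1, h2⟩ n
    refine ⟨fun j hj => ?_, h2 n n.2⟩
    funext r
    change ∑ k, H k n * W j r k = ∑ k, H k n * W' j r k
    rw [h1 j hj]
  · intro h
    exact ⟨fun j hj => hH.eq_of_stored_eq hs fun n hn => (h ⟨n, hn⟩).1 j hj,
      fun n hn => (h ⟨n, hn⟩).2⟩

/-- Given the messages in `S`, the joint entropy of functions of the contents of `K` databases is the
sum of their entropies. -/
theorem IsMDS.logClass_sub_inf_eq {H : Matrix (Fin K) (Fin N) F} (hH : IsMDS H)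
    {s : Finset (Fin N)} (hs : s.card = K) (S : Finset (Fin M)) {α : Type*}
    (f : Fin N → (Fin M → Fin ℓ → F) → α) :
    logClass (agreeOn F K ℓ S) - logClass (agreeOn F K ℓ S ⊓
        s.inf fun n => Setoid.ker fun W => f n (stored H n W)) =
      ∑ n ∈ s, (logClass (agreeOn F K ℓ S) -
        logClass (agreeOn F K ℓ S ⊓ Setoid.ker fun W => f n (stored H n W))) := by
  classical
  simp only [logClass, ← Finset.sum_sub_distrib]
  rw [Finset.sum_comm]
  refine Finset.sum_congr rfl fun W _ => ?_
  set a : Fin N → ℕ := fun n => (Finset.univ.filter fun y : Fin M → Fin ℓ → F =>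
    (∀ j ∈ S, stored H n W j = y j)).card with ha
  set b : Fin N → ℕ := fun n => (Finset.univ.filter fun y : Fin M → Fin ℓ → F =>
    (∀ j ∈ S, stored H n W j = y j) ∧ f n (stored H n W) = f n y).card with hb
  have hapos : ∀ n, (a n : ℝ) ≠ 0 := fun n => by
    have : 0 < a n := Finset.card_pos.2 ⟨stored H n W, by simp⟩
    exact_mod_cast this.ne'
  have hbpos : ∀ n, (b n : ℝ) ≠ 0 := fun n => by
    have : 0 < b n := Finset.card_pos.2 ⟨stored H n W, by simp⟩
    exact_mod_cast this.ne'
  -- constant functions give the class sizes that involve fewer than `K` answers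
  have h0 : classCard (agreeOn F K ℓ S) W = ∏ n ∈ s, a n := by
    have h := hH.classCard_eq_prod hs S (fun _ _ => ()) W
    have ht : (agreeOn F K ℓ S ⊓ s.inf fun n => Setoid.ker fun W : Messages F K M ℓ =>
        (fun _ _ => () : Fin N → (Fin M → Fin ℓ → F) → Unit) n (stored H n W)) =
        agreeOn F K ℓ S := by
      ext W W'
      simp [setoid_inf_apply, finset_inf_setoid_apply, Setoid.ker_def]
    rw [ht] at h
    simpa [ha] using h
  have h1 : ∀ m ∈ s, classCard (agreeOn F K ℓ S ⊓ Setoid.ker fun W => f m (stored H m W)) W =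
      b m * ∏ n ∈ s.erase m, a n := by
    intro m hm
    have h := hH.classCard_eq_prod hs S
      (fun n y => if n = m then some (f n y) else none) W
    have ht : (agreeOn F K ℓ S ⊓ s.inf fun n => Setoid.ker fun W : Messages F K M ℓ =>
        (fun n y => if n = m then some (f n y) else none : Fin N → (Fin M → Fin ℓ → F) → Option α)
          n (stored H n W)) =
        agreeOn F K ℓ S ⊓ Setoid.ker fun W => f m (stored H m W) := by
      ext W W'
      simp only [setoid_inf_apply, finset_inf_setoid_apply, Setoid.ker_def]
      refine and_congr_right fun _ => ⟨fun h => by simpa using h m hm, fun h n hn => ?_⟩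
      by_cases hnm : n = m
      · subst hnm; simp [h]
      · simp [hnm]
    rw [ht] at h
    rw [h, ← Finset.mul_prod_erase s _ hm]
    congr 1
    · simp [hb]
    · refine Finset.prod_congr rfl fun n hn => ?_
      simp [Finset.ne_of_mem_erase hn, ha]
  have h2 := hH.classCard_eq_prod hs S f W
  rw [h0, h2]
  push_cast
  rw [Real.log_prod fun n _ => hapos n, Real.log_prod fun n _ => hbpos n,
    ← Finset.sum_sub_distrib]
  refine Finset.sum_congr rfl fun m hm => ?_
  rw [h1 m hm, ← Finset.add_sum_erase s _ hm]
  push_cast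
  rw [Real.log_mul (hbpos m) (Finset.prod_ne_zero_iff.2 fun n _ => hapos n),
    Real.log_prod fun n _ => hapos n]
  ring

omit [Field F] in
theorem classCard_agreeOn (S : Finset (Fin M)) (W : Messages F K M ℓ) :
    classCard (agreeOn F K ℓ S) W =
      Fintype.card (Matrix (Fin ℓ) (Fin K) F) ^ (M - S.card) := by
  classical
  have : (Finset.univ.filter fun W' => agreeOn F K ℓ S W W') =
      Fintype.piFinset fun j => if j ∈ S then {W j} else Finset.univ := by
    ext W'
    simp only [Finset.mem_filter, Finset.mem_univ, true_and, Fintype.mem_piFinset, agreeOn_apply]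
    refine forall_congr' fun j => ?_
    by_cases hj : j ∈ S <;> simp [hj, eq_comm]
  rw [classCard]
  trans (Finset.univ.filter fun W' => agreeOn F K ℓ S W W').card
  · congr
  rw [this, Fintype.card_piFinset, ← Finset.prod_mul_prod_compl S]
  rw [Finset.prod_eq_one fun j hj => by simp [hj], one_mul,
    Finset.prod_congr rfl (g := fun _ => Fintype.card (Matrix (Fin ℓ) (Fin K) F))
      fun j hj => by simp [Finset.mem_compl.1 hj, Finset.card_univ]]
  rw [Finset.prod_const, Finset.card_compl, Fintype.card_fin]

end Storage

/-! ### Cyclic windows of databases -/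

section Window

variable {K N : ℕ} [NeZero N]

omit [NeZero N] in
theorem window_injective (hKN : K ≤ N) (n : Fin N) :
    Function.Injective fun a : Fin K => n + Fin.castLE hKN a := fun a b h => by
  simpa using h

theorem sum_window (hKN : K ≤ N) (x : Fin N → ℝ) :
    ∑ n : Fin N, ∑ a : Fin K, x (n + Fin.castLE hKN a) = K * ∑ n, x n := by
  rw [Finset.sum_comm]
  have h : ∀ a : Fin K, ∑ n, x (n + Fin.castLE hKN a) = ∑ n, x n := fun a =>
    Equiv.sum_comp (Equiv.addRight (Fin.castLE hKN a)) x
  simp [h]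

end Window

/-! ### The converse -/

section Counting

variable {Ω : Type*} [Fintype Ω] [Nonempty Ω]

theorem map_uniformOfFintype_apply {α : Type*} (a : Ω → α) (ω : Ω) :
    ((PMF.uniformOfFintype Ω).map a (a ω)).toReal =
      classCard (Setoid.ker a) ω / Fintype.card Ω := by
  classical
  rw [PMF.map_apply, tsum_fintype]
  simp only [PMF.uniformOfFintype_apply]
  rw [← Finset.sum_filter, Finset.sum_const, nsmul_eq_mul, ENNReal.toReal_mul, ENNReal.toReal_inv,
    ENNReal.toReal_natCast, ENNReal.toReal_natCast, ← div_eq_mul_inv, classCard]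
  congr

/-- The entropy of a function of a uniform outcome, in terms of class sizes. -/
theorem tsum_negMulLog_map_uniform {α : Type*} (a : Ω → α) :
    ∑' x, ENNReal.ofReal (Real.negMulLog ((PMF.uniformOfFintype Ω).map a x).toReal) =
      ENNReal.ofReal ((logClass (⊤ : Setoid Ω) - logClass (Setoid.ker a)) / Fintype.card Ω) := by
  have hc : (0 : ℝ) < Fintype.card Ω := by exact_mod_cast Fintype.card_pos
  have htop : ∀ ω, classCard (⊤ : Setoid Ω) ω = Fintype.card Ω := fun ω => by
    rw [classCard, ← Finset.card_univ]
    congr 1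
    ext ω'
    simp only [Finset.mem_filter, Finset.mem_univ, true_and, iff_true]
    trivial
  have hlog : ∀ ω, -Real.log ((PMF.uniformOfFintype Ω).map a (a ω)).toReal =
      Real.log (classCard (⊤ : Setoid Ω) ω) - Real.log (classCard (Setoid.ker a) ω) := fun ω => by
    have : (classCard (Setoid.ker a) ω : ℝ) ≠ 0 := by exact_mod_cast (classCard_pos _ _).ne'
    rw [map_uniformOfFintype_apply, Real.log_div this hc.ne', htop, neg_sub]
  simp_rw [fun x => ofReal_negMulLog_toReal _
    (PMF.apply_ne_top ((PMF.uniformOfFintype Ω).map a) x)]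
  rw [tsum_map_mul, tsum_fintype]
  simp_rw [hlog, PMF.uniformOfFintype_apply]
  rw [← Finset.mul_sum, ← ENNReal.ofReal_sum_of_nonneg, Finset.sum_sub_distrib, div_eq_inv_mul,
    ENNReal.ofReal_mul (inv_nonneg.2 hc.le), ENNReal.ofReal_inv_of_pos hc, ENNReal.ofReal_natCast]
  · rfl
  · intro ω _
    rw [← hlog, neg_nonneg]
    exact Real.log_nonpos ENNReal.toReal_nonneg (toReal_apply_le_one _ _)

end Counting

section Converse

variable {F : Type*} [Field F] [Fintype F] {K N M ℓ : ℕ}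

/-- Conditional entropy, given the messages in `S`, of the answer `f` of database `n` to a fixed
query; `f` is the answer as a function of the contents of the database. -/
noncomputable def answerEntropy (H : Matrix (Fin K) (Fin N) F) (S : Finset (Fin M)) (n : Fin N)
    {α : Type*} (f : (Fin M → Fin ℓ → F) → α) : ℝ :=
  (logClass (agreeOn F K ℓ S) -
    logClass (agreeOn F K ℓ S ⊓ Setoid.ker fun W => f (stored H n W))) /
      Fintype.card (Messages F K M ℓ)

theorem answerEntropy_nonneg (H : Matrix (Fin K) (Fin N) F) (S : Finset (Fin M)) (n : Fin N)
    {α : Type*} (f : (Fin M → Fin ℓ → F) → α) : 0 ≤ answerEntropy H S n f :=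
  div_nonneg (sub_nonneg.2 (logClass_mono inf_le_left)) (Nat.cast_nonneg _)

omit [Field F] in
theorem logClass_agreeOn_sub_insert {S : Finset (Fin M)} {i : Fin M} (hi : i ∉ S) :
    logClass (agreeOn F K ℓ S) - logClass (agreeOn F K ℓ (insert i S)) =
      Fintype.card (Messages F K M ℓ) *
        Real.log (Fintype.card (Matrix (Fin ℓ) (Fin K) F)) := by
  have hcard : M - S.card = M - (insert i S).card + 1 := by
    have h1 := Finset.card_le_univ (insert i S)
    rw [Fintype.card_fin] at h1
    rw [Finset.card_insert_of_notMem hi] at h1 ⊢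
    omega
  rw [logClass, logClass, ← Finset.sum_sub_distrib]
  simp only [classCard_agreeOn, hcard, Nat.cast_pow, Real.log_pow]
  rw [Finset.sum_const, nsmul_eq_mul, Finset.card_univ]
  push_cast
  ring

/-- The answers to one realisation of the queries: they reveal the desired message `i`, and by the
independence of the contents of any `K` databases they carry at least a fraction `K / N` of their
total entropy given the messages already known. -/
theorem log_card_add_le_sum_answerEntropy {H : Matrix (Fin K) (Fin N) F} (hH : IsMDS H)
    (hN : 0 < N) (hKN : K ≤ N) {S : Finset (Fin M)} {i : Fin M} (hi : i ∉ S) {α : Type*}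
    (f : Fin N → (Fin M → Fin ℓ → F) → α)
    (hf : ∀ W W' : Messages F K M ℓ,
      (∀ n, f n (stored H n W) = f n (stored H n W')) → W i = W' i) :
    Real.log (Fintype.card (Matrix (Fin ℓ) (Fin K) F)) +
        (K / N : ℝ) * ∑ n, answerEntropy H (insert i S) n (f n) ≤
      ∑ n, answerEntropy H S n (f n) := by
  classical
  have : NeZero N := ⟨hN.ne'⟩
  have hN' : (0 : ℝ) < N := by exact_mod_cast hN
  have hc : (0 : ℝ) < Fintype.card (Messages F K M ℓ) := by exact_mod_cast Fintype.card_pos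
  set r : Fin N → Setoid (Messages F K M ℓ) := fun n => Setoid.ker fun W => f n (stored H n W)
   
  set g := agreeOn F K ℓ S
  set g' := agreeOn F K ℓ (insert i S)
  have h1 : logClass g - logClass (g ⊓ Finset.univ.inf r) ≤
      ∑ n, (logClass g - logClass (g ⊓ r n)) := logClass_sub_inf_le g _ r
  have h2 : logClass (g ⊓ Finset.univ.inf r) ≤ logClass (g' ⊓ Finset.univ.inf r) := by
    refine logClass_mono fun W W' h => ?_
    obtain ⟨hS, hall⟩ := h
    refine ⟨fun j hj => ?_, hall⟩
    rcases Finset.mem_insert.1 hj with rfl | hj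
    · exact hf W W' fun n => (finset_inf_setoid_apply _ r W W').1 hall n (Finset.mem_univ n)
    · exact hS j hj
  have h3 := logClass_agreeOn_sub_insert (F := F) (K := K) (ℓ := ℓ) hi
  have h4 : K * ∑ n, (logClass g' - logClass (g' ⊓ r n)) ≤
      N * (logClass g' - logClass (g' ⊓ Finset.univ.inf r)) := by
    rw [← sum_window hKN]
    calc _ ≤ ∑ _n : Fin N, (logClass g' - logClass (g' ⊓ Finset.univ.inf r)) := by
          refine Finset.sum_le_sum fun n _ => ?_
          have hinj := window_injective hKN n
          have hcard : (Finset.univ.image fun a : Fin K => n + Fin.castLE hKN a).card = K := by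
            rw [Finset.card_image_of_injective _ hinj, Finset.card_univ, Fintype.card_fin]
          have h := hH.logClass_sub_inf_eq hcard (insert i S) f
          rw [Finset.sum_image fun a _ b _ hab => hinj hab] at h
          refine h.ge.trans (sub_le_sub_left (logClass_mono ?_) _)
          exact inf_le_inf_left _ (Finset.inf_mono (Finset.subset_univ _))
      _ = _ := by rw [Finset.sum_const, Finset.card_univ, Fintype.card_fin, nsmul_eq_mul]
  have h5 : (K / N : ℝ) * ∑ n, (logClass g' - logClass (g' ⊓ r n)) ≤
      logClass g' - logClass (g' ⊓ Finset.univ.inf r) := by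
    rw [div_mul_eq_mul_div, div_le_iff₀ hN']
    linarith
  simp only [answerEntropy]
  rw [← Finset.sum_div, ← Finset.sum_div, le_div_iff₀ hc, add_mul, mul_assoc,
    div_mul_cancel₀ _ hc.ne']
  linarith

theorem Scheme.mem_support_law {S : Scheme F N M ℓ} {i : Fin M} {W : Messages F K M ℓ}
    {Q : Fin N → S.Query} : (W, Q) ∈ (S.law K i).support ↔ Q ∈ (S.queryLaw i).support := by
  simp only [Scheme.law, PMF.mem_support_bind_iff, PMF.mem_support_map_iff, Prod.mk.injEq,
    PMF.support_uniformOfFintype]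
  constructor
  · rintro ⟨_, -, Q', hQ, -, rfl⟩
    exact hQ
  · intro h
    exact ⟨W, trivial, Q, h, rfl, rfl⟩

/-- Reliability without entropies: for all queries that occur, the answers determine the desired
message. -/
theorem Scheme.isReliable_iff {H : Matrix (Fin K) (Fin N) F} {S : Scheme F N M ℓ} :
    S.IsReliable H ↔ ∀ i, ∀ Q ∈ (S.queryLaw i).support, ∀ W W' : Messages F K M ℓ,
      (∀ n, S.answer n (Q n) (stored H n W) = S.answer n (Q n) (stored H n W')) →
        W i = W' i := by
  refine forall_congr' fun i => ?_
  rw [condEntropy_eq_zero_iff]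
  constructor
  · intro h Q hQ W W' hW
    refine h (W, Q) (mem_support_law.2 hQ) (W', Q) (mem_support_law.2 hQ) ?_
    exact Prod.ext (funext hW) rfl
  · rintro h ⟨W, Q⟩ hQ ⟨W', Q'⟩ - hY
    obtain ⟨h1, rfl⟩ := Prod.mk.inj hY
    exact h Q (mem_support_law.1 hQ) W W' (congrFun h1)

/-- The law of an answer is the mixture, over the queries, of the laws of the answers to fixed
queries. -/
theorem Scheme.map_law_answerRV (H : Matrix (Fin K) (Fin N) F) (S : Scheme F N M ℓ) (i : Fin M)
    (n : Fin N) : (S.law K i).map (S.answerRV H n) =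
      ((S.queryLaw i).map fun Q => Q n).bind fun q =>
        (PMF.uniformOfFintype (Messages F K M ℓ)).map fun W => S.answer n q (stored H n W) := by
  rw [Scheme.law, PMF.map_bind]
  simp_rw [PMF.map_comp]
  rw [PMF.bind_map]
  simp only [← PMF.bind_pure_comp]
  rw [PMF.bind_comm]
  rfl

theorem Scheme.entropy_message (S : Scheme F N M ℓ) (i : Fin M) :
    entropy (S.law K i) (fun ω => ω.1 i) =
      ENNReal.ofReal (Real.log (Fintype.card (Matrix (Fin ℓ) (Fin K) F))) := by
  apply entropy_eq_of_map_eq_uniform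
  rw [← map_uniformOfFintype_eval (α := Matrix (Fin ℓ) (Fin K) F) i, Scheme.law, PMF.map_bind]
  simp_rw [PMF.map_comp]
  have : ∀ W : Messages F K M ℓ, ((fun ω : Messages F K M ℓ × (Fin N → S.Query) => ω.1 i) ∘
      fun Q => (W, Q)) = Function.const _ (W i) := fun _ => rfl
  simp_rw [this, PMF.map_const]
  rfl

/-- Expected total conditional entropy of the answers, given the queries and the messages in `T`,
when message `i` is desired. -/
noncomputable def Scheme.download (H : Matrix (Fin K) (Fin N) F) (S : Scheme F N M ℓ) (i : Fin M)
    (T : Finset (Fin M)) : ℝ≥0∞ :=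
  ∑ n, ∑' q, ((S.queryLaw i).map fun Q => Q n) q *
    ENNReal.ofReal (answerEntropy H T n (S.answer n q))

theorem Scheme.download_empty_le (H : Matrix (Fin K) (Fin N) F) (S : Scheme F N M ℓ) (i : Fin M) :
    S.download H i ∅ ≤ ∑ n, entropy (S.law K i) (S.answerRV H n) := by
  refine Finset.sum_le_sum fun n _ => ?_
  rw [entropy, map_law_answerRV]
  refine le_trans (le_of_eq ?_) (tsum_mul_entropy_le _ _)
  refine tsum_congr fun q => ?_
  have htop : agreeOn F K ℓ (∅ : Finset (Fin M)) = ⊤ :=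
    top_unique fun _ _ _ j hj => absurd hj (Finset.notMem_empty j)
  rw [tsum_negMulLog_map_uniform, answerEntropy, htop, top_inf_eq]

theorem Scheme.download_congr {S : Scheme F N M ℓ} (hS : S.IsPrivate)
    (H : Matrix (Fin K) (Fin N) F) (i j : Fin M) (T : Finset (Fin M)) :
    S.download H i T = S.download H j T := by
  simp only [download, hS _ i j]

theorem Scheme.download_eq_tsum (H : Matrix (Fin K) (Fin N) F) (S : Scheme F N M ℓ) (i : Fin M)
    (T : Finset (Fin M)) : S.download H i T = ∑' Q, S.queryLaw i Q *
      ENNReal.ofReal (∑ n, answerEntropy H T n (S.answer n (Q n))) := by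
  simp only [download, tsum_map_mul]
  rw [← Summable.tsum_finsetSum fun _ _ => ENNReal.summable]
  refine tsum_congr fun Q => ?_
  rw [← Finset.mul_sum, ENNReal.ofReal_sum_of_nonneg fun n _ => answerEntropy_nonneg _ _ _ _]

theorem Scheme.download_step {H : Matrix (Fin K) (Fin N) F} (hH : IsMDS H) (hN : 0 < N)
    (hKN : K ≤ N) {S : Scheme F N M ℓ} (hR : S.IsReliable H) {T : Finset (Fin M)} {i : Fin M}
    (hi : i ∉ T) :
    ENNReal.ofReal (Real.log (Fintype.card (Matrix (Fin ℓ) (Fin K) F))) +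
      ENNReal.ofReal (K / N) * S.download H i (insert i T) ≤ S.download H i T := by
  rw [download_eq_tsum, download_eq_tsum, ← ENNReal.tsum_mul_left,
    ← one_mul (ENNReal.ofReal (Real.log _)), ← (S.queryLaw i).tsum_coe, ← ENNReal.tsum_mul_right,
    ← ENNReal.tsum_add]
  refine ENNReal.tsum_le_tsum fun Q => ?_
  rw [mul_left_comm, ← mul_add]
  by_cases hQ : S.queryLaw i Q = 0
  · simp [hQ]
  refine mul_le_mul_right ?_ _
  have hsum : 0 ≤ ∑ n, answerEntropy H (insert i T) n (S.answer n (Q n)) :=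
    Finset.sum_nonneg fun n _ => answerEntropy_nonneg _ _ _ _
  have hKN0 : (0 : ℝ) ≤ K / N := by positivity
  rw [← ENNReal.ofReal_mul hKN0, ← ENNReal.ofReal_add (Real.log_natCast_nonneg _)
    (mul_nonneg hKN0 hsum)]
  exact ENNReal.ofReal_le_ofReal (log_card_add_le_sum_answerEntropy hH hN hKN hi _
    (isReliable_iff.1 hR i Q ((PMF.mem_support_iff _ _).2 hQ)))

/-- The desired index is free in each step because of privacy, so that the messages can be
revealed one after the other. -/
theorem Scheme.geom_le_download {H : Matrix (Fin K) (Fin N) F} (hH : IsMDS H) (hN : 0 < N)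
    (hKN : K ≤ N) {S : Scheme F N M ℓ} (hP : S.IsPrivate) (hR : S.IsReliable H) (i : Fin M)
    (m : ℕ) (T : Finset (Fin M)) (hm : m + T.card = M) :
    ENNReal.ofReal (Real.log (Fintype.card (Matrix (Fin ℓ) (Fin K) F)) *
      ∑ t ∈ Finset.range m, (K / N : ℝ) ^ t) ≤ S.download H i T := by
  induction m generalizing T with
  | zero => simp
  | succ m ih =>
    obtain ⟨j, hj⟩ : ∃ j, j ∉ T := by
      by_contra! h
      have : T = Finset.univ := Finset.eq_univ_iff_forall.2 h
      rw [this, Finset.card_univ, Fintype.card_fin] at hm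
      omega
    have h := ih (insert j T) (by rw [Finset.card_insert_of_notMem hj]; omega)
    have hKN0 : (0 : ℝ) ≤ K / N := by positivity
    have hlog := Real.log_natCast_nonneg (Fintype.card (Matrix (Fin ℓ) (Fin K) F))
    rw [download_congr hP H i j] at h ⊢
    refine le_trans ?_ (download_step hH hN hKN hR hj)
    refine le_trans (le_of_eq ?_) (add_le_add_right (mul_le_mul_right h _) _)
    rw [← ENNReal.ofReal_mul hKN0, ← ENNReal.ofReal_add hlog (by positivity)]
    congr 1
    rw [Finset.sum_range_succ', mul_left_comm, Finset.mul_sum]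
    simp only [pow_succ', pow_zero]
    ring

theorem log_card_message_pos (hK : 0 < K) (hℓ : 0 < ℓ) :
    0 < Real.log (Fintype.card (Matrix (Fin ℓ) (Fin K) F)) := by
  have : Nonempty (Fin ℓ) := ⟨⟨0, hℓ⟩⟩
  have : Nonempty (Fin K) := ⟨⟨0, hK⟩⟩
  exact Real.log_pos (by exact_mod_cast Fintype.one_lt_card)

theorem Scheme.rate_le {H : Matrix (Fin K) (Fin N) F} (hH : IsMDS H) (hK : 0 < K)
    (hKN : K ≤ N) (hℓ : 0 < ℓ) {S : Scheme F N M ℓ} (hP : S.IsPrivate) (hR : S.IsReliable H)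
    (i : Fin M) :
    S.rate H i ≤ ENNReal.ofReal (∑ t ∈ Finset.range M, (K / N : ℝ) ^ t)⁻¹ := by
  have hM : 0 < M := i.pos
  have hlog := log_card_message_pos (F := F) hK hℓ
  have hgeom : 0 < ∑ t ∈ Finset.range M, (K / N : ℝ) ^ t := by
    have hN : 0 < N := hK.trans_le hKN
    exact Finset.sum_pos (fun t _ => by positivity) (Finset.nonempty_range_iff.2 hM.ne')
  have h := (geom_le_download hH (hK.trans_le hKN) hKN hP hR i M ∅ (by simp)).trans
    (download_empty_le H S i)
  rw [rate, entropy_message]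
  refine (ENNReal.div_le_div_left h _).trans (le_of_eq ?_)
  rw [← ENNReal.ofReal_div_of_pos (mul_pos hlog hgeom)]
  congr 1
  field_simp

end Converse

/-! ### Numbers of sums in the answers -/

section Count

/-- With `u` messages in total, the number of sums in one answer that combine a given set of `k`
messages. When `K = N`, the convention `0 ^ 0 = 1` leaves just the single symbols. The value for
`u = M - 1` counts the side-information rows `(T, s, b)` with given `T` of size `k` and given `s`
(see `sideRow`). -/
def slotCount (K N u : ℕ) : ℕ → ℕ
  | 0 => 0
  | k + 1 => K ^ (u - k) * (N - K) ^ k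

variable {K N : ℕ} {ι : Type*} [DecidableEq ι]

theorem sum_slotCount_insert (hKN : K ≤ N) {U : Finset ι} {j : ι} (hj : j ∉ U) :
    ∑ T ∈ U.powerset, slotCount K N (U.card + 1) (insert j T).card = K * N ^ U.card := by
  have h := Finset.sum_pow_mul_eq_add_pow (N - K) K U
  rw [Nat.sub_add_cancel hKN] at h
  rw [← h, Finset.mul_sum]
  refine Finset.sum_congr rfl fun T hT => ?_
  have hTU := Finset.mem_powerset.1 hT
  have hle := Finset.card_le_card hTU
  rw [Finset.card_insert_of_notMem fun h => hj (hTU h), slotCount, Nat.sub_add_comm hle, pow_succ]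
  ring

theorem sum_slotCount (hKN : K ≤ N) (U : Finset ι) :
    ∑ T ∈ U.powerset, slotCount K N U.card T.card =
      ∑ m ∈ Finset.range U.card, K ^ (m + 1) * N ^ (U.card - 1 - m) := by
  induction U using Finset.induction_on with
  | empty => simp [slotCount]
  | insert j U hj ih =>
    have h1 : ∑ T ∈ U.powerset, slotCount K N (U.card + 1) T.card =
        K * ∑ T ∈ U.powerset, slotCount K N U.card T.card := by
      rw [Finset.mul_sum]
      refine Finset.sum_congr rfl fun T hT => ?_
      have hle := Finset.card_le_card (Finset.mem_powerset.1 hT)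
      rcases h : T.card with _ | k
      · simp [slotCount]
      · rw [slotCount, slotCount, Nat.sub_add_comm (by omega), pow_succ]
        ring
    rw [Finset.sum_powerset_insert hj, Finset.card_insert_of_notMem hj, h1, ih,
      sum_slotCount_insert hKN hj, Finset.sum_range_succ', Finset.mul_sum]
    congr 1
    · refine Finset.sum_congr rfl fun m _ => ?_
      rw [show U.card + 1 - 1 - (m + 1) = U.card - 1 - m by omega]
      ring
    · simp

theorem sum_slotCount_mem (hKN : K ≤ N) {U : Finset ι} {j : ι} (hj : j ∈ U) :
    ∑ T ∈ U.powerset with j ∈ T, slotCount K N U.card T.card = K * N ^ (U.card - 1) := by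
  obtain ⟨V, hV, rfl⟩ : ∃ V, j ∉ V ∧ insert j V = U :=
    ⟨U.erase j, Finset.notMem_erase j U, Finset.insert_erase hj⟩
  rw [Finset.sum_filter, Finset.sum_powerset_insert hV, Finset.card_insert_of_notMem hV,
    Nat.add_sub_cancel, ← sum_slotCount_insert hKN hV, Finset.sum_eq_zero, zero_add]
  · exact Finset.sum_congr rfl fun T _ => if_pos (Finset.mem_insert_self j T)
  · exact fun T hT => if_neg fun h => hV (Finset.mem_powerset.1 hT h)

end Count

/-! ### Placement of the message rows in the answers -/

section Placement

/-- The positions in an answer: a set `T` of messages, of which the answer contains a sum, and an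
index that distinguishes the sums of this type. -/
abbrev Slot (K N M : ℕ) : Type := Σ T : Finset (Fin M), Fin (slotCount K N M T.card)

variable {K N M : ℕ}

theorem card_slot (hKN : K ≤ N) : Fintype.card (Slot K N M) =
    ∑ m ∈ Finset.range M, K ^ (m + 1) * N ^ (M - 1 - m) := by
  have h := sum_slotCount hKN (Finset.univ : Finset (Fin M))
  rw [Finset.powerset_univ, Finset.card_univ, Fintype.card_fin] at h
  simp [Fintype.card_sigma, ← h]

theorem card_slot_mem (hKN : K ≤ N) (i : Fin M) :
    (Finset.univ.filter fun σ : Slot K N M => i ∈ σ.1).card = K * N ^ (M - 1) := by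
  have h := sum_slotCount_mem hKN (Finset.mem_univ i)
  rw [Finset.powerset_univ, Finset.card_univ, Fintype.card_fin] at h
  have hs : (Finset.univ.filter fun σ : Slot K N M => i ∈ σ.1) =
      (Finset.univ.filter fun T : Finset (Fin M) => i ∈ T).sigma fun _ => Finset.univ := by
    ext σ
    simp
  rw [hs, Finset.card_sigma, ← h]
  simp

theorem slotCount_eq_mul {k : ℕ} (hk : k ≤ M) :
    slotCount K N M k = K * slotCount K N (M - 1) k := by
  rcases k with _ | k
  · simp [slotCount]
  · rw [slotCount, slotCount, show M - k = M - 1 - k + 1 by omega, pow_succ]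
    ring

theorem slotCount_succ_eq_mul {k : ℕ} (hk : 0 < k) :
    slotCount K N M (k + 1) = (N - K) * slotCount K N (M - 1) k := by
  obtain ⟨k, rfl⟩ := Nat.exists_eq_succ_of_ne_zero hk.ne'
  rw [slotCount, Nat.succ_eq_add_one, slotCount, show M - (k + 1) = M - 1 - k by omega, pow_succ]
  ring

/-- The label of the side-information row used in the slot `σ` of the answer of database `n`, when
message `i` is desired. It consists of the set `T` of undesired messages in the sum, a database
`s`, and an index `b`. The row occurs without a desired symbol at the `K` databases
`s, s - 1, …, s - (K - 1)` (modulo `N`), and added to a desired symbol at the `N - K` others. In a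
slot that contains only the desired message, `T` is empty and the label is meaningless. -/
def sideRow [NeZero N] (i : Fin M) (n : Fin N) (σ : Slot K N M) :
    Finset (Fin M) × Fin N × ℕ :=
  (σ.1.erase i,
    n + Fin.ofNat N ((if i ∈ σ.1 then K else 0) +
      σ.2 / slotCount K N (M - 1) (σ.1.erase i).card),
    σ.2 % slotCount K N (M - 1) (σ.1.erase i).card)

theorem sideRow_bounds (hKN : K ≤ N) {i : Fin M} {σ : Slot K N M} (hσ : (σ.1.erase i).Nonempty) :
    0 < slotCount K N (M - 1) (σ.1.erase i).card ∧
    (if i ∈ σ.1 then K else 0) + σ.2 / slotCount K N (M - 1) (σ.1.erase i).card < N ∧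
    (i ∉ σ.1 → σ.2 / slotCount K N (M - 1) (σ.1.erase i).card < K) := by
  obtain ⟨T, x, hx⟩ := σ
  simp only at hσ ⊢
  have hle := Finset.card_le_univ T
  rw [Fintype.card_fin] at hle
  by_cases hi : i ∈ T
  · rw [← Finset.card_erase_add_one hi, slotCount_succ_eq_mul (Finset.card_pos.2 hσ)] at hx
    have hdiv := Nat.div_lt_of_lt_mul (by rwa [mul_comm] at hx)
    have hpos : 0 < slotCount K N (M - 1) (T.erase i).card :=
      Nat.pos_of_ne_zero fun h => by simp [h] at hx
    refine ⟨hpos, ?_, fun h => absurd hi h⟩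
    rw [if_pos hi]
    omega
  · rw [slotCount_eq_mul hle] at hx
    rw [Finset.erase_eq_of_notMem hi]
    have hdiv := Nat.div_lt_of_lt_mul (by rwa [mul_comm] at hx)
    have hpos : 0 < slotCount K N (M - 1) T.card :=
      Nat.pos_of_ne_zero fun h => by simp [h] at hx
    refine ⟨hpos, ?_, fun _ => hdiv⟩
    rw [if_neg hi]
    omega

theorem sideRow_injective [NeZero N] (hKN : K ≤ N) {i : Fin M} (n : Fin N) {σ σ' : Slot K N M}
    (hσ : (σ.1.erase i).Nonempty) (hσ' : (σ'.1.erase i).Nonempty)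
    (h : sideRow i n σ = sideRow i n σ') : σ = σ' := by
  obtain ⟨-, h1, h2⟩ := sideRow_bounds hKN hσ
  obtain ⟨-, h1', h2'⟩ := sideRow_bounds hKN hσ'
  simp only [sideRow, Prod.mk.injEq, add_right_inj] at h
  obtain ⟨he, hd, hm⟩ := h
  rw [← he] at h1' h2' hd hm
  have hd' := congrArg Fin.val hd
  rw [Fin.val_ofNat, Fin.val_ofNat, Nat.mod_eq_of_lt h1, Nat.mod_eq_of_lt h1'] at hd'
  have hi : i ∈ σ.1 ↔ i ∈ σ'.1 := by
    by_cases hi : i ∈ σ.1 <;> by_cases hi' : i ∈ σ'.1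
    · exact ⟨fun _ => hi', fun _ => hi⟩
    · have := h2' hi'
      rw [if_pos hi, if_neg hi', zero_add] at hd'
      exact absurd ((Nat.le_add_right K _).trans hd'.le) (not_le.2 this)
    · have := h2 hi
      rw [if_neg hi, if_pos hi', zero_add] at hd'
      exact absurd ((Nat.le_add_right K _).trans hd'.ge) (not_le.2 this)
    · exact ⟨fun h => absurd h hi, fun h => absurd h hi'⟩
  have hT : σ.1 = σ'.1 := by
    ext j
    by_cases hj : j = i
    · rw [hj, hi]
    · have := Finset.ext_iff.1 he j
      simpa [hj] using this
  have hx : (σ.2 : ℕ) = σ'.2 := by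
    simp only [hi, add_right_inj] at hd'
    rw [← Nat.div_add_mod (σ.2 : ℕ) (slotCount K N (M - 1) (σ.1.erase i).card), hd', hm,
      Nat.div_add_mod]
  obtain ⟨T, x⟩ := σ
  obtain ⟨T', x'⟩ := σ'
  simp only at hT
  subst hT
  exact Sigma.ext rfl (heq_of_eq (Fin.ext hx))

/-- The side-information rows for desired message `i` that involve message `j`. -/
def sideRows (K : ℕ) {N M : ℕ} (i j : Fin M) : Finset (Finset (Fin M) × Fin N × ℕ) :=
  ((Finset.univ.erase i).powerset.filter (j ∈ ·)).biUnion fun T =>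
    {T} ×ˢ Finset.univ ×ˢ Finset.range (slotCount K N (M - 1) T.card)

theorem card_sideRows_le (hKN : K ≤ N) {i j : Fin M} (hij : j ≠ i) :
    (sideRows K i j : Finset (Finset (Fin M) × Fin N × ℕ)).card ≤ N ^ M := by
  refine Finset.card_biUnion_le.trans ?_
  have hM : M - 1 - 1 + 1 + 1 = M := by
    have h1 := i.2
    have h2 := j.2
    have h3 := Fin.val_ne_of_ne hij
    omega
  have h := sum_slotCount_mem hKN (Finset.mem_erase.2 ⟨hij, Finset.mem_univ j⟩)
  rw [Finset.card_erase_of_mem (Finset.mem_univ i), Finset.card_univ, Fintype.card_fin] at h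
  simp only [Finset.card_product, Finset.card_singleton, one_mul, Finset.card_univ,
    Fintype.card_fin, Finset.card_range]
  rw [← Finset.mul_sum, h]
  calc N * (K * N ^ (M - 1 - 1)) ≤ N * (N * N ^ (M - 1 - 1)) := by gcongr
    _ = N ^ (M - 1 - 1 + 1 + 1) := by ring
    _ = N ^ M := by rw [hM]

theorem sideRow_mem_sideRows [NeZero N] (hKN : K ≤ N) {i j : Fin M} (hij : j ≠ i) (n : Fin N)
    {σ : Slot K N M} (hj : j ∈ σ.1) : sideRow i n σ ∈ sideRows K i j := by
  have hj' : j ∈ σ.1.erase i := Finset.mem_erase.2 ⟨hij, hj⟩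
  refine Finset.mem_biUnion.2 ⟨σ.1.erase i, ?_, ?_⟩
  · exact Finset.mem_filter.2 ⟨Finset.mem_powerset.2
      (Finset.erase_subset_erase i (Finset.subset_univ _)), hj'⟩
  · simp [sideRow, Nat.mod_lt _ (sideRow_bounds hKN ⟨j, hj'⟩).1]

theorem exists_injOn_of_card_le {α β : Type*} [Fintype β] [Nonempty β] (s : Finset α)
    (h : s.card ≤ Fintype.card β) : ∃ f : α → β, Set.InjOn f s := by
  classical
  obtain ⟨f⟩ := Function.Embedding.nonempty_of_card_le (α := s) (β := β) (by simpa using h)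
  refine ⟨fun a => if ha : a ∈ s then f ⟨a, ha⟩ else Classical.arbitrary β, ?_⟩
  intro a ha b hb hab
  simp only [Finset.mem_coe] at ha hb
  simpa [ha, hb] using hab

theorem exists_bijOn_of_card_eq {α β : Type*} [Fintype β] [Nonempty β] (s : Finset α)
    (h : s.card = Fintype.card β) :
    ∃ f : α → β, Set.InjOn f s ∧ ∀ b, ∃ a ∈ s, f a = b := by
  classical
  obtain ⟨f, hf⟩ := exists_injOn_of_card_le s h.le
  refine ⟨f, hf, fun b => ?_⟩
  have : s.image f = Finset.univ :=
    Finset.eq_univ_of_card _ (by rw [Finset.card_image_of_injOn hf, h])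
  exact Finset.mem_image.1 (this ▸ Finset.mem_univ b)

variable {F : Type*} [Field F]

theorem IsMDS.eq_zero_of_window [NeZero N] {H : Matrix (Fin K) (Fin N) F} (hH : IsMDS H)
    (hKN : K ≤ N) (s : Fin N) {v : Fin K → F}
    (hv : ∀ a : Fin K, ∑ k, H k (s - Fin.castLE hKN a) * v k = 0) : v = 0 := by
  have hinj : Function.Injective fun a : Fin K => s - Fin.castLE hKN a := fun a b h => by
    simpa using h
  refine hH.eq_zero_of_column_eq_zero
    (s := Finset.univ.image fun a : Fin K => s - Fin.castLE hKN a) ?_ fun n hn => ?_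
  · rw [Finset.card_image_of_injective _ hinj, Finset.card_univ, Fintype.card_fin]
  · obtain ⟨a, -, rfl⟩ := Finset.mem_image.1 hn
    exact hv a

/-- For each desired message `i` the rows of the messages can be placed in the slots of the
answers, such that no database sees a row twice, and such that the answers determine message `i`
(stated for the difference of two message contents with equal answers). -/
theorem exists_placement {H : Matrix (Fin K) (Fin N) F} (hH : IsMDS H) (hK : 0 < K) (hKN : K ≤ N)
    (i : Fin M) : ∃ pos : Fin N → Fin M → Slot K N M → Fin (N ^ M),
      (∀ n j, Set.InjOn (pos n j) {σ | j ∈ σ.1}) ∧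
      ∀ D : Messages F K M (N ^ M),
        (∀ n σ, ∑ j ∈ σ.1, ∑ k, H k n * D j (pos n j σ) k = 0) → D i = 0 := by
  have hN : 0 < N := hK.trans_le hKN
  have hM : M - 1 + 1 = M := Nat.sub_add_cancel i.pos
  have : NeZero N := ⟨hN.ne'⟩
  have : NeZero K := ⟨hK.ne'⟩
  obtain ⟨e, he, he'⟩ := exists_bijOn_of_card_eq (β := Fin K × Fin (N ^ (M - 1)))
    (Finset.univ.filter fun σ : Slot K N M => i ∈ σ.1) (by rw [card_slot_mem hKN]; simp)
  have g : Fin N × Fin (N ^ (M - 1)) ≃ Fin (N ^ M) :=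
    Fintype.equivOfCardEq (by simp [← pow_succ', hM])
  have hρ : ∀ j, ∃ ρ : Finset (Fin M) × Fin N × ℕ → Fin (N ^ M),
      j ≠ i → Set.InjOn ρ (sideRows K i j : Finset (Finset (Fin M) × Fin N × ℕ)) := fun j => by
    by_cases hij : j = i
    · exact ⟨fun _ => 0, fun h => absurd hij h⟩
    · obtain ⟨ρ, h⟩ := exists_injOn_of_card_le (β := Fin (N ^ M)) (sideRows K i j)
        (by simpa using card_sideRows_le hKN hij)
      exact ⟨ρ, fun _ => h⟩
  choose ρ hρ using hρ
  -- row `(s, b)` of the desired message is read by the databases `s, s - 1, …, s - (K - 1)`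
  refine ⟨fun n j σ => if j = i then g (n + Fin.castLE hKN (e σ).1, (e σ).2)
    else ρ j (sideRow i n σ), fun n j => ?_, fun D hD => ?_⟩
  · intro σ hσ σ' hσ' h
    simp only [Set.mem_ofPred_eq] at hσ hσ'
    by_cases hij : j = i
    · subst hij
      simp only [if_true, EmbeddingLike.apply_eq_iff_eq, Prod.mk.injEq, add_right_inj,
        Fin.castLE_inj] at h
      exact he (by simpa using hσ) (by simpa using hσ') (Prod.ext h.1 h.2)
    · simp only [if_neg hij] at h
      exact sideRow_injective hKN n ⟨j, Finset.mem_erase.2 ⟨hij, hσ⟩⟩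
        ⟨j, Finset.mem_erase.2 ⟨hij, hσ'⟩⟩ (hρ j hij (sideRow_mem_sideRows hKN hij n hσ)
          (sideRow_mem_sideRows hKN hij n hσ') h)
  -- the side information vanishes, since `K` databases deliver it without a desired symbol
  have hside : ∀ (T : Finset (Fin M)) (s : Fin N) (b : ℕ), i ∉ T → T.Nonempty →
      b < slotCount K N (M - 1) T.card →
      (fun k => ∑ j ∈ T, D j (ρ j (T, s, b)) k) = 0 := by
    intro T s b hi hT hb
    refine hH.eq_zero_of_window hKN s fun a => ?_
    have hle := Finset.card_le_univ T
    rw [Fintype.card_fin] at hle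
    have hx : slotCount K N (M - 1) T.card * a + b < slotCount K N M T.card := by
      rw [slotCount_eq_mul hle]
      have := a.2
      nlinarith
    have h := hD (s - Fin.castLE hKN a) ⟨T, _, hx⟩
    have hrow : sideRow i (s - Fin.castLE hKN a) (⟨T, _, hx⟩ : Slot K N M) = (T, s, b) := by
      have hN' : Fin.ofNat N (a : ℕ) = Fin.castLE hKN a := by
        ext
        simp [Nat.mod_eq_of_lt (a.2.trans_le hKN)]
      simp only [sideRow, Finset.erase_eq_of_notMem hi, if_neg hi, zero_add,
        Nat.mul_add_div (b.zero_le.trans_lt hb), Nat.div_eq_of_lt hb, add_zero, hN',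
        sub_add_cancel, Nat.mul_add_mod, Nat.mod_eq_of_lt hb]
    rw [Finset.sum_comm] at h
    rw [← h]
    refine Finset.sum_congr rfl fun k _ => ?_
    rw [Finset.mul_sum]
    refine Finset.sum_congr rfl fun j hj => ?_
    have hji : j ≠ i := fun h => hi (h ▸ hj)
    simp only [if_neg hji, hrow]
  -- hence each answer with a desired symbol reveals it
  ext r k
  obtain ⟨⟨s, b⟩, rfl⟩ := g.surjective r
  refine congrFun (hH.eq_zero_of_window hKN s (v := D i (g (s, b))) fun a => ?_) k
  obtain ⟨σ, hσ, heσ⟩ := he' (a, b)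
  simp only [Finset.mem_filter, Finset.mem_univ, true_and] at hσ
  have h := hD (s - Fin.castLE hKN a) σ
  rw [← Finset.add_sum_erase _ _ hσ] at h
  simp only [if_true, heσ, sub_add_cancel] at h
  rwa [add_eq_left.2] at h
  by_cases hne : (σ.1.erase i).Nonempty
  · have hv := hside (σ.1.erase i) (sideRow i (s - Fin.castLE hKN a) σ).2.1
      (sideRow i (s - Fin.castLE hKN a) σ).2.2 (Finset.notMem_erase i _) hne
      (Nat.mod_lt _ (sideRow_bounds hKN hne).1)
    rw [Finset.sum_comm]
    refine Finset.sum_eq_zero fun k _ => ?_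
    rw [← Finset.mul_sum, Finset.sum_congr rfl fun j hj => by
      rw [if_neg (Finset.ne_of_mem_erase hj)]]
    exact (congrArg _ (congrFun hv k)).trans (mul_zero _)
  · rw [Finset.not_nonempty_iff_eq_empty.1 hne, Finset.sum_empty]

end Placement

/-! ### The capacity-achieving scheme -/

section Achievability

theorem exists_perm_comp_eq {α β : Type*} [Fintype β] {f g : α → β} (hf : Function.Injective f)
    (hg : Function.Injective g) : ∃ τ : Equiv.Perm β, ∀ a, τ (g a) = f a := by
  classical
  set e := (Equiv.ofInjective g hg).symm.trans (Equiv.ofInjective f hf)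
  refine ⟨e.extendSubtype, fun a => ?_⟩
  rw [Equiv.extendSubtype_apply_of_mem e (g a) ⟨a, rfl⟩]
  change (Equiv.ofInjective f hf ((Equiv.ofInjective g hg).symm (Equiv.ofInjective g hg a)) : β) = _
  rw [Equiv.symm_apply_apply, Equiv.ofInjective_apply]

/-- Composing an injection with a uniformly random permutation gives a law that does not depend on
the injection. -/
theorem map_uniform_perm_congr {ι β : Type*} [Fintype ι] [DecidableEq ι] [Fintype β]
    [DecidableEq β] {α : ι → Type*} {f g : ∀ j, α j → β} (hf : ∀ j, Function.Injective (f j))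
    (hg : ∀ j, Function.Injective (g j)) :
    (PMF.uniformOfFintype (ι → Equiv.Perm β)).map (fun π j a => π j (f j a)) =
      (PMF.uniformOfFintype (ι → Equiv.Perm β)).map (fun π j a => π j (g j a)) := by
  choose τ hτ using fun j => exists_perm_comp_eq (hf j) (hg j)
  conv_rhs => rw [← map_uniformOfFintype_equiv (Equiv.mulRight τ), PMF.map_comp]
  congr 1
  funext π j a
  simp [hτ]

variable {F : Type*} [Field F] [Fintype F] {K N M : ℕ}

/-- The retrieval scheme of a placement of rows in slots: the user permutes the rows of each message
privately and uniformly at random, and asks for the sums of the symbols in these rows. Each database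
learns only the rows to be added up in each slot. -/
noncomputable def placementScheme (F : Type*) [Field F] [Fintype F] {K N M : ℕ}
    (pos : Fin M → Fin N → Fin M → Slot K N M → Fin (N ^ M)) : Scheme F N M (N ^ M) where
  Query := ∀ j : Fin M, {σ : Slot K N M // j ∈ σ.1} → Fin (N ^ M)
  Answer := Slot K N M → Fin (Fintype.card F)
  queryLaw i := (PMF.uniformOfFintype (Fin M → Equiv.Perm (Fin (N ^ M)))).map
    fun π n j σ => π j (pos i n j σ.1)
  answer _ q y σ := Fintype.equivFin F (∑ j : σ.1, y j (q j ⟨σ, j.2⟩))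

theorem placementScheme_isPrivate {pos : Fin M → Fin N → Fin M → Slot K N M → Fin (N ^ M)}
    (hpos : ∀ i n j, Set.InjOn (pos i n j) {σ | j ∈ σ.1}) :
    (placementScheme F pos).IsPrivate := by
  intro n i j
  simp only [placementScheme, PMF.map_comp]
  exact map_uniform_perm_congr
    (f := fun j' (σ : {σ : Slot K N M // j' ∈ σ.1}) => pos i n j' σ.1)
    (g := fun j' (σ : {σ : Slot K N M // j' ∈ σ.1}) => pos j n j' σ.1)
    (fun j' => (hpos i n j').injective) (fun j' => (hpos j n j').injective)

theorem placementScheme_isReliable {H : Matrix (Fin K) (Fin N) F}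
    {pos : Fin M → Fin N → Fin M → Slot K N M → Fin (N ^ M)}
    (hpos : ∀ i, ∀ D : Messages F K M (N ^ M),
      (∀ n σ, ∑ j ∈ σ.1, ∑ k, H k n * D j (pos i n j σ) k = 0) → D i = 0) :
    (placementScheme F pos).IsReliable H := by
  rw [Scheme.isReliable_iff]
  intro i Q hQ W W' h
  obtain ⟨π, -, rfl⟩ := (PMF.mem_support_map_iff _ _ _).1 hQ
  have hD := hpos i (fun j r k => W j (π j r) k - W' j (π j r) k) fun n σ => by
    have := (Fintype.equivFin F).injective (congrFun (h n) σ)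
    simp only [stored, Finset.sum_coe_sort σ.1 fun j => ∑ k, H k n * W j (π j (pos i n j σ)) k,
      Finset.sum_coe_sort σ.1 fun j => ∑ k, H k n * W' j (π j (pos i n j σ)) k] at this
    simp only [mul_sub, Finset.sum_sub_distrib, this, sub_self]
  ext r k
  obtain ⟨r, rfl⟩ := (π i).surjective r
  exact sub_eq_zero.1 (congrFun (congrFun hD r) k)

theorem le_placementScheme_rate (H : Matrix (Fin K) (Fin N) F) (hK : 0 < K) (hKN : K ≤ N)
    (pos : Fin M → Fin N → Fin M → Slot K N M → Fin (N ^ M)) (i : Fin M) :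
    ENNReal.ofReal (∑ t ∈ Finset.range M, (K / N : ℝ) ^ t)⁻¹ ≤
      (placementScheme F pos).rate H i := by
  have hN : 0 < N := hK.trans_le hKN
  have hN' : (0 : ℝ) < N := by exact_mod_cast hN
  have hK' : (0 : ℝ) < K := by exact_mod_cast hK
  have hlog : 0 < Real.log (Fintype.card F) :=
    Real.log_pos (by exact_mod_cast Fintype.one_lt_card)
  have hgeom : 0 < ∑ t ∈ Finset.range M, (K / N : ℝ) ^ t :=
    Finset.sum_pos (fun t _ => by positivity) (Finset.nonempty_range_iff.2 i.pos.ne')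
  have hX : Real.log (Fintype.card (Matrix (Fin (N ^ M)) (Fin K) F)) =
      N ^ M * K * Real.log (Fintype.card F) := by
    rw [Fintype.card_congr (Matrix.of (m := Fin (N ^ M)) (n := Fin K) (α := F)).symm]
    simp only [Fintype.card_fun, Fintype.card_fin, Nat.cast_pow, Real.log_pow]
    ring
  -- the length of the answers
  have hslot : (N : ℝ) * Fintype.card (Slot K N M) =
      N ^ M * K * ∑ t ∈ Finset.range M, (K / N : ℝ) ^ t := by
    rw [card_slot hKN]
    push_cast
    rw [Finset.mul_sum, Finset.mul_sum]
    refine Finset.sum_congr rfl fun t ht => ?_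
    have hM : M = M - 1 - t + t + 1 := by
      have := Finset.mem_range.1 ht
      omega
    have hpow : (N : ℝ) ^ M = N ^ (M - 1 - t) * N ^ t * N := by
      conv_lhs => rw [hM]
      rw [pow_succ, pow_add]
    rw [hpow, div_pow, pow_succ]
    field_simp
  have hent : ∀ n, entropy ((placementScheme F pos).law K i)
      ((placementScheme F pos).answerRV H n) ≤
      ENNReal.ofReal (Fintype.card (Slot K N M) * Real.log (Fintype.card F)) := fun n => by
    have h := entropy_le_log_card (α := Slot K N M → Fin (Fintype.card F))
      ((placementScheme F pos).law K i) ((placementScheme F pos).answerRV H n)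
    rw [Fintype.card_fun, Fintype.card_fin, Nat.cast_pow, Real.log_pow] at h
    exact h
  have hsum : ∑ n, entropy ((placementScheme F pos).law K i)
      ((placementScheme F pos).answerRV H n) ≤ ENNReal.ofReal (N ^ M * K *
        (∑ t ∈ Finset.range M, (K / N : ℝ) ^ t) * Real.log (Fintype.card F)) := by
    refine (Finset.sum_le_sum fun n _ => hent n).trans (le_of_eq ?_)
    rw [← hslot, Finset.sum_const, Finset.card_univ, Fintype.card_fin, nsmul_eq_mul,
      ← ENNReal.ofReal_natCast, ← ENNReal.ofReal_mul (Nat.cast_nonneg _), mul_assoc]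
  rw [Scheme.rate, Scheme.entropy_message, hX]
  refine le_trans (le_of_eq ?_) (ENNReal.div_le_div_left hsum _)
  rw [← ENNReal.ofReal_div_of_pos (by positivity)]
  congr 1
  field_simp

end Achievability

end CodedPIR

theorem theorem1 {F : Type*} [Field F] [Fintype F] {K N M : ℕ} (hK : 0 < K) (hKN : K ≤ N)
    (hM : 0 < M) (H : Matrix (Fin K) (Fin N) F) (hH : CodedPIR.IsMDS H) :
    CodedPIR.capacity H M
        = ENNReal.ofReal (∑ i ∈ Finset.range M, ((K : ℝ) / (N : ℝ)) ^ i)⁻¹ ∧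
    (K < N → CodedPIR.capacity H M
        = ENNReal.ofReal ((1 - (K : ℝ) / (N : ℝ)) / (1 - ((K : ℝ) / (N : ℝ)) ^ M))) ∧
    (∃ S : CodedPIR.Scheme F N M (N ^ M), S.IsPrivate ∧ S.IsReliable H ∧
      ∀ i : Fin M, S.rate H i = CodedPIR.capacity H M) := by
  have hN : 0 < N := hK.trans_le hKN
  choose pos hinj hdec using fun i : Fin M => CodedPIR.exists_placement hH hK hKN i
  have hP := CodedPIR.placementScheme_isPrivate (F := F) hinj
  have hR := CodedPIR.placementScheme_isReliable hdec
  have hrate : ∀ i, (CodedPIR.placementScheme F pos).rate H i =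
      ENNReal.ofReal (∑ i ∈ Finset.range M, ((K : ℝ) / (N : ℝ)) ^ i)⁻¹ := fun i =>
    le_antisymm (CodedPIR.Scheme.rate_le hH hK hKN (pow_pos hN M) hP hR i)
      (CodedPIR.le_placementScheme_rate H hK hKN pos i)
  have hcap : CodedPIR.capacity H M =
      ENNReal.ofReal (∑ i ∈ Finset.range M, ((K : ℝ) / (N : ℝ)) ^ i)⁻¹ := by
    refine le_antisymm ?_ ?_
    · refine iSup_le fun ℓ => iSup_le fun hℓ => iSup_le fun S => iSup_le fun hP =>
        iSup_le fun hR => ?_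
      exact (iInf_le _ ⟨0, hM⟩).trans (CodedPIR.Scheme.rate_le hH hK hKN hℓ hP hR _)
    · refine le_iSup_of_le (N ^ M) (le_iSup_of_le (pow_pos hN M) (le_iSup_of_le
        (CodedPIR.placementScheme F pos) (le_iSup_of_le hP (le_iSup_of_le hR ?_))))
      exact le_iInf fun i => (hrate i).ge
  refine ⟨hcap, fun hlt => ?_, _, hP, hR, fun i => (hrate i).trans hcap.symm⟩
  have hne : (K / N : ℝ) ≠ 1 := by
    rw [ne_eq, div_eq_one_iff_eq (by exact_mod_cast hN.ne')]
    exact_mod_cast hlt.ne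
  rw [hcap, geom_sum_eq hne, inv_div, ← neg_div_neg_eq, neg_sub, neg_sub]
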